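/- An instance-solution problem $\mathsf P$ consists of a set of instances and, for each instance, a set of solutions, all coded as elements of $\mathbb N^{\mathbb N}$. $\mathsf P$ is Weihrauch reducible to $\mathsf Q$, written $\mathsf P\le_{\mathrm W}\mathsf Q$, if there are Turing functionals $H,K$ such that for every $\mathsf P$-instance $x$, $H(x)$ is a $\mathsf Q$-instance, and for every $\mathsf Q$-solution $v$ to $H(x)$, $K(x\oplus v)$ is a $\mathsf P$-solution to $x$. We write $\mathsf P\lneq_{\mathrm W}\mathsf Q$ if $\mathsf P\le_{\mathrm W}\mathsf Q$ and $\mathsf Q\not\le_{\mathrm W}\mathsf P$. The parallel product $\mathsf P\times\mathsf Q$ has as instances the pairs $(x_0,x_1)$ of a $\mathsf P$-instance and a $\mathsf Q$-instance, and as solutions to $(x_0,x_1)$ the pairs $(y_0,y_1)$ such that $y_0$ is a $\mathsf P$-solution to $x_0$ and $y_1$ is a $\mathsf Q$-solution to $x_1$. $\mathsf{ECT}$ is the problem whose instances are the pairs $(n,f)$ with $n\in\mathbb N$ and $f:\mathbb N\to\{0,\dots,n-1\}$, and whose solutions to $(n,f)$ are the $b\in\mathbb N$ such that $\forall x>b\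 \exists y>x\ f(x)=f(y)$. For a linear order $X$, let $X^\omega$ be the set of finite sequences $\langle(b_0,a_0),\dots,(b_n,a_n)\rangle$ with $b_i\in\mathbb N$, $b_0>\dots>b_n$, and $0\ne a_i\in X$ (where $0$ is the least element of $X$; the condition $a_i \neq 0$ is void if $X$ has no least element), ordered lexicographically: a proper prefix of a sequence is smaller than the sequence, and otherwise the first pair in which the two sequences differ decides, where $(b,a)>(b',a')$ if $b>b'$, or $b=b'$ and $a>_Xa'$. $\mathsf{WOP}(X\mapsto X^\omega)$ is the problem whose instances consist of a linear order $(X,\le_X)$ with $X\subseteq\mathbb N$ and an infinite strictly decreasing sequence $\sigma=(\sigma_i)_{i\ge0}$ in $X^\omega$, and whose solutions are the infinite strictly decreasing sequences $\sigma'=(\sigma'_i)_{i\ge 0}$ in $X$ that are contained in $\sigma$, i.e. for which there are $t_0\le t_1\le\cdots$ such that, for each $i$, $\sigma'_i$ is one of the coefficients $a_j$ of $\sigma_{t_i}$. Then $$\mathsf{WOP}(X\mapsto X^\omega)\ \lneq_{\mathrm W}\ \mathsf{ECT}\times\mathsf{WOP}(X\mapsto X^\omega).$$ -/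

import Mathlib

namespace Weihrauch

/-! ### Turing functionals -/

/-- Turing functionals (partial recursive functionals): the functions `Φ` that map an oracle
`f : ℕ → ℕ` to a partial function `Φ f : ℕ →. ℕ` and that are computed by one program, uniformly in
the oracle. They form the least class that contains zero, successor, the two projections of the
pairing function and the oracle itself, and that is closed under pairing, composition, primitive
recursion and unbounded search. The clauses are those of `Nat.RecursiveIn`, with the oracle as a
parameter. -/
inductive TuringFunctional : ((ℕ → ℕ) → ℕ →. ℕ) → Prop
  | zero : TuringFunctional fun _ _ => Part.some 0
  | succ : TuringFunctional fun _ n => Part.some (n + 1)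
  | left : TuringFunctional fun _ n => Part.some n.unpair.1
  | right : TuringFunctional fun _ n => Part.some n.unpair.2
  | oracle : TuringFunctional fun f n => Part.some (f n)
  | pair {Φ Ψ : (ℕ → ℕ) → ℕ →. ℕ} (hΦ : TuringFunctional Φ) (hΨ : TuringFunctional Ψ) :
      TuringFunctional fun f n => (Φ f n).bind fun a => (Ψ f n).map fun b => Nat.pair a b
  | comp {Φ Ψ : (ℕ → ℕ) → ℕ →. ℕ} (hΦ : TuringFunctional Φ) (hΨ : TuringFunctional Ψ) :
      TuringFunctional fun f n => (Ψ f n).bind fun a => Φ f a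
  | prec {Φ Ψ : (ℕ → ℕ) → ℕ →. ℕ} (hΦ : TuringFunctional Φ) (hΨ : TuringFunctional Ψ) :
      TuringFunctional fun f n =>
        Nat.rec (motive := fun _ => Part ℕ) (Φ f n.unpair.1)
          (fun y ih => ih.bind fun i => Ψ f (Nat.pair n.unpair.1 (Nat.pair y i))) n.unpair.2
  | rfind {Φ : (ℕ → ℕ) → ℕ →. ℕ} (hΦ : TuringFunctional Φ) :
      TuringFunctional fun f a =>
        Nat.rfind fun n => (Φ f (Nat.pair a n)).map fun m => decide (m = 0)

/-- `Maps Φ x y`: the functional `Φ` is total on the oracle `x`, and `Φ x` is the sequence `y`. -/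
def Maps (Φ : (ℕ → ℕ) → ℕ →. ℕ) (x y : ℕ → ℕ) : Prop :=
  ∀ n, y n ∈ Φ x n

/-- The join `x ⊕ y`: `x` on the even and `y` on the odd places. -/
def join (x y : ℕ → ℕ) : ℕ → ℕ :=
  fun n => if n % 2 = 0 then x (n / 2) else y (n / 2)

/-- First component of `p`, read as the join of two sequences. -/
def fstPart (p : ℕ → ℕ) : ℕ → ℕ := fun n => p (2 * n)

/-- Second component of `p`, read as the join of two sequences. -/
def sndPart (p : ℕ → ℕ) : ℕ → ℕ := fun n => p (2 * n + 1)

/-! ### Problems and Weihrauch reducibility -/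

/-- An instance-solution problem, whose instances and solutions are (coded as) elements of `ℕ^ℕ`. -/
structure Problem where
  /-- `x` is an instance. -/
  IsInstance : (ℕ → ℕ) → Prop
  /-- `y` is a solution to the instance `x`. -/
  IsSolution : (ℕ → ℕ) → (ℕ → ℕ) → Prop

/-- Weihrauch reducibility. -/
def WeihrauchLE (P Q : Problem) : Prop :=
  ∃ H K : (ℕ → ℕ) → ℕ →. ℕ, TuringFunctional H ∧ TuringFunctional K ∧
    ∀ x, P.IsInstance x → ∃ u, Maps H x u ∧ Q.IsInstance u ∧
      ∀ v, Q.IsSolution u v → ∃ y, Maps K (join x v) y ∧ P.IsSolution x y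

/-- `P` is strictly Weihrauch-below `Q`. -/
def WeihrauchLT (P Q : Problem) : Prop :=
  WeihrauchLE P Q ∧ ¬ WeihrauchLE Q P

/-- The parallel product of two problems; pairs are coded by the join. -/
def Problem.prod (P Q : Problem) : Problem where
  IsInstance x := P.IsInstance (fstPart x) ∧ Q.IsInstance (sndPart x)
  IsSolution x y := P.IsSolution (fstPart x) (fstPart y) ∧ Q.IsSolution (sndPart x) (sndPart y)

/-! ### Eventually constant palette tail -/

/-- The problem `ECT`. The pair `(n, f)` is coded by the sequence `n, f 0, f 1, …`; a sequence `y`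
codes the natural number `y 0`. -/
def ECT : Problem where
  IsInstance p := ∀ i, p (i + 1) < p 0
  IsSolution p y := ∀ x > y 0, ∃ z > x, p (x + 1) = p (z + 1)

/-! ### The operator `X ↦ X ^ ω` -/

/-- The strict part of `le`. -/
def strict (le : ℕ → ℕ → Prop) (a b : ℕ) : Prop := le a b ∧ ¬ le b a

/-- The elements `⟨(b₀, a₀), …, (bₙ, aₙ)⟩` of `X ^ ω`, for a set `X` of natural numbers that is
linearly ordered by `le`: the exponents `bᵢ` are strictly decreasing, and each coefficient `aᵢ` is a
nonzero element of `X`, that is, not the least element of `X` (if `X` has one). -/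
def IsTerm (X : Set ℕ) (le : ℕ → ℕ → Prop) (s : List (ℕ × ℕ)) : Prop :=
  (s.map Prod.fst).Pairwise (· > ·) ∧
    ∀ u ∈ s, u.2 ∈ X ∧ ∃ c ∈ X, strict le c u.2

/-- The lexicographic order on `X ^ ω`: proper prefixes are smaller, and otherwise the first
difference decides, where pairs are compared by exponent first and by coefficient second. -/
def termLT (le : ℕ → ℕ → Prop) (s t : List (ℕ × ℕ)) : Prop :=
  List.Lex (Prod.Lex (· < ·) (strict le)) s t

/-! ### The problem `WOP (X ↦ X ^ ω)` -/

/-- An instance `p` of `WOP (X ↦ X ^ ω)` is the join of (the characteristic function of) `X`, the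
join of (the characteristic function of) the order of `X`, and a sequence of codes of elements of
`X ^ ω`. This is the set `X`. -/
def carrier (p : ℕ → ℕ) : Set ℕ := {a | fstPart p a = 1}

/-- The order relation `≤_X` coded by `p`. -/
def orderRel (p : ℕ → ℕ) (a b : ℕ) : Prop := fstPart (sndPart p) (Nat.pair a b) = 1

/-- The sequence of finite sequences of pairs coded by `p`. -/
def termSeq (p : ℕ → ℕ) (n : ℕ) : List (ℕ × ℕ) :=
  Denumerable.ofNat (List (ℕ × ℕ)) (sndPart (sndPart p) n)

/-- The problem `WOP (X ↦ X ^ ω)`: given a linear order `X` and an infinite decreasing sequence `σ`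
in `X ^ ω`, find an infinite decreasing sequence in `X` that is contained in `σ`, i.e. whose `i`-th
entry is a coefficient of the term `σ (t i)`, with `t i ≤ t j` for `i < j`. -/
def WOPpowOmega : Problem where
  IsInstance p :=
    IsLinearOrder (carrier p) (fun a b : carrier p => orderRel p a b) ∧
      (∀ n, IsTerm (carrier p) (orderRel p) (termSeq p n)) ∧
      ∀ n, termLT (orderRel p) (termSeq p (n + 1)) (termSeq p n)
  IsSolution p y :=
    (∀ i, y i ∈ carrier p) ∧
      (∀ i, strict (orderRel p) (y (i + 1)) (y i)) ∧
      ∃ t : ℕ → ℕ, Monotone t ∧ ∀ i, ∃ b, (b, y i) ∈ termSeq p (t i)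

end Weihrauch

/-!
Turing functionals are continuous, so it suffices that no continuous functionals reduce the product.
Suppose that some do, and apply them to instances of the product that depend continuously on a
sequence `w` of bits: `w` is the colouring, and the indices `t` with `w t = true` are the drop times
of a decreasing sequence over the linear order of `ω + 1` copies of the reversed natural numbers,
whose solutions leave the topmost copy if and only if the drop times are finitely many. The inner
instances then form a continuous family of decreasing sequences of terms. On some open set of
parameters all of these have a common column, a fixed prefix followed by a fixed exponent, along
which the coefficients decrease and, for generic parameters, never stabilise.

Following the column at a generic parameter `w₁` gives an inner solution, from which the reduction
computes a bound for the colouring `w₁` using finitely many steps only. Some `w₂` close to `w₁` has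
a last `true` beyond this bound. The same steps cannot be continued to an inner solution at `w₂`, so
no inner solution at `w₂` that starts late enough gets below the coefficients of the column. Take
such a solution; the decreasing sequence computed from it must leave the topmost copy, because `w₂`
has finitely many drop times, and finitely many steps are enough to see this. At a generic `w₃`
close to `w₂` these steps lie above the column and can be continued along it. But `w₃` has
infinitely many drop times, so that no solution leaves the topmost copy.
-/

namespace Weihrauch

open Filter Topology

@[simp]
theorem fstPart_join (x y : ℕ → ℕ) : fstPart (join x y) = x := by
  ext n
  simp [fstPart, join]

@[simp]
theorem sndPart_join (x y : ℕ → ℕ) : sndPart (join x y) = y := by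
  ext n
  simp [sndPart, join, show (2 * n + 1) / 2 = n by lia]

namespace TuringFunctional

theorem of_primrec {g : ℕ → ℕ} (hg : Nat.Primrec g) :
    TuringFunctional fun _ n => Part.some (g n) := by
  induction hg with
  | zero => exact .zero
  | succ => exact .succ
  | left => exact .left
  | right => exact .right
  | pair _ _ hf hg => simpa using hf.pair hg
  | comp _ _ hf hg => simpa using hf.comp hg
  | prec _ _ hf hg =>
    refine Eq.mp (congrArg TuringFunctional ?_) (hf.prec hg)
    funext _ n
    simp only [Nat.unpaired]
    induction n.unpair.2 with
    | zero => rfl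
    | succ k ih =>
      dsimp only
      rw [ih, Part.bind_some]

variable {F G : (ℕ → ℕ) → ℕ → ℕ}

theorem comp_primrec (hF : TuringFunctional fun f n => Part.some (F f n)) {g : ℕ → ℕ}
    (hg : Primrec g) : TuringFunctional fun f n => Part.some (F f (g n)) := by
  simpa using hF.comp (of_primrec (Primrec.nat_iff.1 hg))

theorem join (hF : TuringFunctional fun f n => Part.some (F f n))
    (hG : TuringFunctional fun f n => Part.some (G f n)) :
    TuringFunctional fun f n => Part.some (Weihrauch.join (F f) (G f) n) := by
  have half : Primrec fun n : ℕ => n / 2 := Primrec.nat_div.comp .id (.const 2)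
  have select : Primrec fun m : ℕ =>
      if m.unpair.1 % 2 = 0 then m.unpair.2.unpair.1 else m.unpair.2.unpair.2 :=
    have fst : Primrec fun m : ℕ => m.unpair.1 := Primrec.fst.comp .unpair
    have snd : Primrec fun m : ℕ => m.unpair.2 := Primrec.snd.comp .unpair
    .ite (Primrec.eq.comp (Primrec.nat_mod.comp fst (.const 2)) (.const 0))
      (fst.comp snd) (snd.comp snd)
  simpa [Weihrauch.join] using (of_primrec (Primrec.nat_iff.1 select)).comp
    ((of_primrec Nat.Primrec.id).pair ((hF.comp_primrec half).pair (hG.comp_primrec half)))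

theorem sndPart (hF : TuringFunctional fun f n => Part.some (F f n)) :
    TuringFunctional fun f n => Part.some (Weihrauch.sndPart (F f) n) :=
  hF.comp_primrec Primrec.nat_double_succ

end TuringFunctional

theorem weihrauchLE_prod_of_computable_instance {P Q : Problem} {q : ℕ → ℕ}
    (hq : TuringFunctional fun _ n => Part.some (q n)) (hqQ : Q.IsInstance q) :
    WeihrauchLE P (Q.prod P) := by
  refine ⟨_, _, hq.join .oracle, TuringFunctional.oracle.sndPart.sndPart, fun x hx =>
    ⟨join q x, fun _ => Part.mem_some _, ⟨by simpa using hqQ, by simpa using hx⟩, fun v hv =>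
      ⟨sndPart v, fun n => ?_, by simpa using hv.2⟩⟩⟩
  simp

theorem weihrauchLE_ECT_prod (P : Problem) : WeihrauchLE P (ECT.prod P) :=
  weihrauchLE_prod_of_computable_instance (q := fun n => 1 - n)
    (.of_primrec (Primrec.nat_iff.1 (Primrec.nat_sub.comp (.const 1) .id))) fun i => by simp

/-- Continuous functionals, the topological counterpart of the Turing functionals: each value that
`Φ` takes on an oracle is taken on a whole neighbourhood of this oracle. -/
def ContinuousFunctional (Φ : (ℕ → ℕ) → ℕ →. ℕ) : Prop :=
  ∀ n y, IsOpen {f | y ∈ Φ f n}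

/-- Weihrauch reducibility by continuous functionals, that is, relative to some oracle. -/
def ContinuousWeihrauchLE (P Q : Problem) : Prop :=
  ∃ H K : (ℕ → ℕ) → ℕ →. ℕ, ContinuousFunctional H ∧ ContinuousFunctional K ∧
    ∀ x, P.IsInstance x → ∃ u, Maps H x u ∧ Q.IsInstance u ∧
      ∀ v, Q.IsSolution u v → ∃ y, Maps K (join x v) y ∧ P.IsSolution x y

section Continuity

variable {W : Type*} [TopologicalSpace W]

theorem isOpen_mem_bind {α β : Type*} {F : W → Part α} {G : W → α → Part β} {b : β}
    (hF : ∀ a, IsOpen {w | a ∈ F w}) (hG : ∀ a, IsOpen {w | b ∈ G w a}) :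
    IsOpen {w | b ∈ (F w).bind (G w)} := by
  simp only [Part.mem_bind_iff, Set.ofPred_exists]
  exact isOpen_iUnion fun a => (hF a).inter (hG a)

theorem isOpen_mem_map {α β : Type*} {F : W → Part α} (g : α → β) (b : β)
    (hF : ∀ a, IsOpen {w | a ∈ F w}) : IsOpen {w | b ∈ (F w).map g} := by
  simp only [Part.mem_map_iff, Set.ofPred_exists]
  exact isOpen_iUnion fun a => (hF a).inter isOpen_const

theorem isOpen_mem_rfind {F : W → ℕ →. Bool} (hF : ∀ n b, IsOpen {w | b ∈ F w n}) (n : ℕ) :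
    IsOpen {w | n ∈ Nat.rfind (F w)} := by
  simp only [Nat.mem_rfind, Set.ofPred_and, Set.ofPred_forall]
  exact (hF n true).inter ((Set.finite_Iio n).isOpen_biInter fun m _ => hF m false)

theorem TuringFunctional.continuousFunctional {Φ : (ℕ → ℕ) → ℕ →. ℕ} (hΦ : TuringFunctional Φ) :
    ContinuousFunctional Φ := by
  induction hΦ with
  | zero | succ | left | right => exact fun _ _ => isOpen_const
  | oracle =>
    intro n y
    simp only [Part.mem_some_iff]
    exact (isOpen_discrete {a | y = a}).preimage (continuous_apply n)
  | pair _ _ hΦ hΨ =>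
    exact fun n y => isOpen_mem_bind (hΦ n) fun a => isOpen_mem_map _ _ (hΨ n)
  | comp _ _ hΦ hΨ => exact fun n y => isOpen_mem_bind (hΨ n) fun a => hΦ a y
  | prec _ _ hΦ hΨ =>
    intro n
    dsimp only
    induction n.unpair.2 with
    | zero => exact hΦ _
    | succ k ih => exact fun y => isOpen_mem_bind ih fun a => hΨ _ y
  | rfind _ hΦ =>
    exact fun n => isOpen_mem_rfind fun m b => isOpen_mem_map _ _ (hΦ _)

theorem WeihrauchLE.continuousWeihrauchLE {P Q : Problem} (h : WeihrauchLE P Q) :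
    ContinuousWeihrauchLE P Q := by
  obtain ⟨H, K, hH, hK, hred⟩ := h
  exact ⟨H, K, hH.continuousFunctional, hK.continuousFunctional, hred⟩

theorem ContinuousFunctional.continuous_of_maps {Φ : (ℕ → ℕ) → ℕ →. ℕ}
    (hΦ : ContinuousFunctional Φ) {x u : W → ℕ → ℕ} (hx : Continuous x)
    (hu : ∀ w, Maps Φ (x w) (u w)) : Continuous u := by
  refine continuous_pi fun n => continuous_discrete_rng.2 fun y => ?_
  convert (hΦ n y).preimage hx using 1
  ext w
  exact ⟨fun h => h ▸ hu w n, Part.mem_unique (hu w n)⟩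

@[fun_prop]
theorem continuous_join {x y : W → ℕ → ℕ} (hx : Continuous x) (hy : Continuous y) :
    Continuous fun w => join (x w) (y w) := by
  refine continuous_pi fun n => ?_
  unfold join
  split_ifs <;> fun_prop

@[fun_prop]
theorem continuous_fstPart {x : W → ℕ → ℕ} (hx : Continuous x) :
    Continuous fun w => fstPart (x w) := by
  unfold fstPart
  fun_prop

@[fun_prop]
theorem continuous_sndPart {x : W → ℕ → ℕ} (hx : Continuous x) :
    Continuous fun w => sndPart (x w) := by
  unfold sndPart
  fun_prop

theorem exists_forall_lt_imp_mem_of_mem_nhds {α : Type*} [TopologicalSpace α] [DiscreteTopology α]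
    {f : ℕ → α} {s : Set (ℕ → α)} (hs : s ∈ 𝓝 f) :
    ∃ k, ∀ g : ℕ → α, (∀ i < k, g i = f i) → g ∈ s := by
  obtain ⟨_, ⟨x, k, rfl⟩, hf, hk⟩ :=
    (PiNat.isTopologicalBasis_cylinders fun _ : ℕ => α).mem_nhds_iff.1 hs
  exact ⟨k, fun g hg => hk fun i hi => (hg i hi).trans (hf i hi)⟩

theorem ContinuousFunctional.exists_modulus {Φ : (ℕ → ℕ) → ℕ →. ℕ} (hΦ : ContinuousFunctional Φ)
    {x : W → ℕ → ℕ} (hx : Continuous x) {w : W} {v : ℕ → ℕ} {n y : ℕ}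
    (h : y ∈ Φ (join (x w) v) n) :
    ∃ k, ∀ᶠ w' in 𝓝 w, ∀ v' : ℕ → ℕ, (∀ i < k, v' i = v i) → y ∈ Φ (join (x w') v') n := by
  have hopen : IsOpen {p : W × (ℕ → ℕ) | y ∈ Φ (join (x p.1) p.2) n} :=
    (hΦ n y).preimage (continuous_join (hx.comp continuous_fst) continuous_snd)
  obtain ⟨A, hA, B, hB, hAB⟩ := mem_nhds_prod_iff.1 (hopen.mem_nhds h)
  obtain ⟨k, hk⟩ := exists_forall_lt_imp_mem_of_mem_nhds hB
  exact ⟨k, mem_of_superset hA fun w' hw' v' hv' => hAB (Set.mk_mem_prod hw' (hk v' hv'))⟩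

theorem tendsto_nhds_of_forall_lt_eq {α : Type*} [TopologicalSpace α] {f : ℕ → α}
    {g : ℕ → ℕ → α} (h : ∀ n, ∀ i < n, g n i = f i) : Tendsto g atTop (𝓝 f) :=
  tendsto_pi_nhds.2 fun i =>
    tendsto_const_nhds.congr' ((eventually_gt_atTop i).mono fun n hn => (h n i hn).symm)

end Continuity

section Category

variable {W : Type*} [TopologicalSpace W]

theorem eventually_residual_mem_of_subset_closure {O E : Set W} (hE : IsOpen E)
    (hOE : O ⊆ closure E) : ∀ᶠ w in residual W, w ∈ O → w ∈ E := by
  have hdense : Dense (E ∪ (closure O)ᶜ) := by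
    rw [dense_iff_closure_eq, closure_union, Set.eq_univ_iff_forall]
    intro w
    by_cases hw : w ∈ closure O
    · exact .inl (closure_minimal hOE isClosed_closure hw)
    · exact .inr (subset_closure hw)
  filter_upwards [residual_of_dense_open (hE.union isClosed_closure.isOpen_compl) hdense]
    with w hw hwO
  exact hw.resolve_right fun h => h (subset_closure hwO)

instance [BaireSpace W] (w : W) : (𝓝 w ⊓ residual W).NeBot :=
  inf_neBot_iff.2 fun _ hs _ ht => mem_closure_iff_nhds.1 (dense_of_mem_residual ht w) _ hs

end Category

/-! ### Columns of decreasing sequences of terms -/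

section Terms

/-- The sequence of terms `ρ` has from `s` on the column at `(pre, b)`: all its terms extend `pre`,
and the next pair has exponent `b`. -/
def IsColumn (ρ : ℕ → List (ℕ × ℕ)) (pre : List (ℕ × ℕ)) (b s : ℕ) : Prop :=
  ∀ t ≥ s, ∃ c r, ρ t = pre ++ (b, c) :: r

/-- The coefficient at position `j` of a term, with junk value `0` beyond the end. -/
def coeffAt (j : ℕ) (s : List (ℕ × ℕ)) : ℕ := (s.getD j (0, 0)).2

/-- The coefficients at position `j` of the sequence of terms `ρ` do not stabilise; `s` is the index
from which on they are considered. -/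
def CoeffVaries (ρ : ℕ → List (ℕ × ℕ)) (j s : ℕ) : Prop :=
  ∀ t ≥ s, ∃ t' ≥ t, coeffAt j (ρ t') ≠ coeffAt j (ρ t)

@[simp]
theorem coeffAt_append_cons (pre : List (ℕ × ℕ)) (b c : ℕ) (r : List (ℕ × ℕ)) :
    coeffAt pre.length (pre ++ (b, c) :: r) = c := by
  simp [coeffAt]

instance (le : ℕ → ℕ → Prop) : Std.Irrefl (strict le) where
  irrefl _ h := h.2 h.1

variable {le : ℕ → ℕ → Prop}

theorem termLT_append_left_iff {s t : List (ℕ × ℕ)} (pre : List (ℕ × ℕ)) :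
    termLT le (pre ++ s) (pre ++ t) ↔ termLT le s t := by
  induction pre with
  | nil => rfl
  | cons a pre ih => exact List.lex_cons_iff.trans ih

theorem fst_le_of_termLT_cons {a' a : ℕ × ℕ} {r' r : List (ℕ × ℕ)}
    (h : termLT le (a' :: r') (a :: r)) : a'.1 ≤ a.1 := by
  obtain h | ⟨rfl, -⟩ := List.cons_lex_cons_iff.1 h
  · obtain h | ⟨h, -⟩ := Prod.lex_def.1 h
    exacts [h.le, h.le]
  · rfl

theorem eq_or_strict_of_termLT_cons {b c' c : ℕ} {r' r : List (ℕ × ℕ)}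
    (h : termLT le ((b, c') :: r') ((b, c) :: r)) : c' = c ∨ strict le c' c := by
  obtain h | ⟨h, -⟩ := List.cons_lex_cons_iff.1 h
  · obtain h | ⟨-, h⟩ := Prod.lex_def.1 h
    exacts [(lt_irrefl b h).elim, .inr h]
  · exact .inl (congrArg Prod.snd h)

theorem exists_eq_append_cons {ρ : ℕ → List (ℕ × ℕ)}
    (hdec : ∀ t, termLT le (ρ (t + 1)) (ρ t)) {pre : List (ℕ × ℕ)} {s : ℕ}
    (hpre : ∀ t ≥ s, pre <+: ρ t) {t : ℕ} (ht : s ≤ t) :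
    ∃ b c r, ρ t = pre ++ (b, c) :: r := by
  obtain ⟨r, hr⟩ := hpre t ht
  obtain ⟨r', hr'⟩ := hpre (t + 1) (ht.trans t.le_succ)
  have h := hdec t
  rw [← hr, ← hr', termLT_append_left_iff] at h
  cases r with
  | nil => exact (List.not_lex_nil h).elim
  | cons a r => exact ⟨a.1, a.2, r, hr.symm⟩

theorem exponent_le {ρ : ℕ → List (ℕ × ℕ)} (hdec : ∀ t, termLT le (ρ (t + 1)) (ρ t))
    {pre : List (ℕ × ℕ)} {s : ℕ} (hpre : ∀ t ≥ s, pre <+: ρ t) {b c : ℕ} {r : List (ℕ × ℕ)}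
    (hs : ρ s = pre ++ (b, c) :: r) {t : ℕ} (ht : s ≤ t) {b' c' : ℕ} {r' : List (ℕ × ℕ)}
    (heq : ρ t = pre ++ (b', c') :: r') : b' ≤ b := by
  induction t, ht using Nat.le_induction generalizing b' c' r' with
  | base => simp_all
  | succ t ht ih =>
    obtain ⟨b₁, c₁, r₁, h₁⟩ := exists_eq_append_cons hdec hpre ht
    have h := hdec t
    rw [h₁, heq, termLT_append_left_iff] at h
    exact (fst_le_of_termLT_cons h).trans (ih h₁)

end Terms

section Columns

variable {W : Type*} [TopologicalSpace W] {le : W → ℕ → ℕ → Prop} {ρ : W → ℕ → List (ℕ × ℕ)}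

theorem exists_isColumn (hρ : ∀ t, IsLocallyConstant fun w => ρ w t)
    (hdec : ∀ w t, termLT (le w) (ρ w (t + 1)) (ρ w t)) {O : Set W} (hO : IsOpen O)
    (hne : O.Nonempty) {pre : List (ℕ × ℕ)} {s : ℕ} (hpre : ∀ w ∈ O, ∀ t ≥ s, pre <+: ρ w t) :
    ∃ O' ⊆ O, IsOpen O' ∧ O'.Nonempty ∧ ∃ b, ∃ s' ≥ s, ∀ w ∈ O', IsColumn (ρ w) pre b s' := by
  let exponents : Set ℕ := {b | ∃ w ∈ O, ∃ t ≥ s, ∃ c r, ρ w t = pre ++ (b, c) :: r}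
  have hexponents : exponents.Nonempty := by
    obtain ⟨w, hw⟩ := hne
    obtain ⟨b, h⟩ := exists_eq_append_cons (hdec w) (hpre w hw) le_rfl
    exact ⟨b, w, hw, s, le_rfl, h⟩
  obtain ⟨b, ⟨w₀, hw₀, t₀, ht₀, c₀, r₀, h₀⟩, hmin⟩ := wellFounded_lt.has_min _ hexponents
  refine ⟨O ∩ {w | ρ w t₀ = ρ w₀ t₀}, Set.inter_subset_left,
    hO.inter ((hρ t₀).isOpen_fiber _), ⟨w₀, hw₀, rfl⟩, b, t₀, ht₀, fun w ⟨hw, hwt₀⟩ t ht => ?_⟩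
  have hpre' : ∀ t ≥ t₀, pre <+: ρ w t := fun t ht => hpre w hw t (ht₀.le.trans ht)
  obtain ⟨b', c', r', h'⟩ := exists_eq_append_cons (hdec w) hpre' ht
  obtain rfl : b' = b := (exponent_le (hdec w) hpre' (hwt₀.trans h₀) ht h').antisymm
    (not_lt.1 (hmin b' ⟨w, hw, t, ht₀.le.trans ht, c', r', h'⟩))
  exact ⟨c', r', h'⟩

/-- A column of least possible exponent. If its coefficient were constant on an open set, then the
terms there would have a further column, of smaller exponent. -/
theorem exists_isColumn_subset_closure [Nonempty W]
    (hρ : ∀ t, IsLocallyConstant fun w => ρ w t)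
    (hdec : ∀ w t, termLT (le w) (ρ w (t + 1)) (ρ w t))
    (hexp : ∀ w t, ((ρ w t).map Prod.fst).Pairwise (· > ·)) :
    ∃ O : Set W, IsOpen O ∧ O.Nonempty ∧ ∃ pre b s, (∀ w ∈ O, IsColumn (ρ w) pre b s) ∧
      ∀ t ≥ s, O ⊆ closure {w | ∃ t' ≥ t, coeffAt pre.length (ρ w t') ≠
        coeffAt pre.length (ρ w t)} := by
  let exponents : Set ℕ := {b | ∃ O : Set W, IsOpen O ∧ O.Nonempty ∧
    ∃ pre s, ∀ w ∈ O, IsColumn (ρ w) pre b s}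
  have hexponents : exponents.Nonempty := by
    obtain ⟨O, -, hO, hne, b, s, -, hcol⟩ := exists_isColumn hρ hdec isOpen_univ
      Set.univ_nonempty (pre := []) (s := 0) fun _ _ _ _ => List.nil_prefix
    exact ⟨b, O, hO, hne, [], s, hcol⟩
  obtain ⟨b, ⟨O, hO, hne, pre, s, hcol⟩, hmin⟩ := wellFounded_lt.has_min _ hexponents
  refine ⟨O, hO, hne, pre, b, s, hcol, fun t ht w₀ hw₀ => by_contra fun hconstant => ?_⟩
  obtain ⟨c, r, hcr⟩ := hcol w₀ hw₀ t ht
  set changes := {w | ∃ t' ≥ t, coeffAt pre.length (ρ w t') ≠ coeffAt pre.length (ρ w t)}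
  have hpre : ∀ w ∈ O ∩ {w | ρ w t = ρ w₀ t} ∩ (closure changes)ᶜ, ∀ t' ≥ t,
      pre ++ [(b, c)] <+: ρ w t' := by
    rintro w ⟨⟨hw, hwt⟩, hw'⟩ t' ht'
    have heq : coeffAt pre.length (ρ w t') = coeffAt pre.length (ρ w t) :=
      by_contra fun hchange => hw' (subset_closure ⟨t', ht', hchange⟩)
    obtain ⟨c', r', h'⟩ := hcol w hw t' (ht.le.trans ht')
    rw [h', hwt, hcr, coeffAt_append_cons, coeffAt_append_cons] at heq
    exact ⟨r', by simp [h', heq]⟩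
  obtain ⟨O', -, hO', ⟨w, hw⟩, b', s', -, hcol'⟩ := exists_isColumn hρ hdec
    ((hO.inter ((hρ t).isOpen_fiber _)).inter isClosed_closure.isOpen_compl)
    ⟨w₀, ⟨hw₀, rfl⟩, hconstant⟩ hpre
  obtain ⟨c', r', h'⟩ := hcol' w hw s' le_rfl
  have hlt : b' < b := by
    have := hexp w s'
    rw [h'] at this
    simp_all [List.pairwise_append]
  exact hmin b' ⟨O', hO', ⟨w, hw⟩, _, s', hcol'⟩ hlt

theorem exists_isColumn_coeffVaries [Nonempty W] (hρ : ∀ t, IsLocallyConstant fun w => ρ w t)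
    (hdec : ∀ w t, termLT (le w) (ρ w (t + 1)) (ρ w t))
    (hexp : ∀ w t, ((ρ w t).map Prod.fst).Pairwise (· > ·)) :
    ∃ O : Set W, IsOpen O ∧ O.Nonempty ∧ ∃ pre b s, (∀ w ∈ O, IsColumn (ρ w) pre b s) ∧
      ∀ᶠ w in residual W, w ∈ O → CoeffVaries (ρ w) pre.length s := by
  obtain ⟨O, hO, hne, pre, b, s, hcol, hclosure⟩ := exists_isColumn_subset_closure hρ hdec hexp
  refine ⟨O, hO, hne, pre, b, s, hcol, ?_⟩
  have hopen (t : ℕ) :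
      IsOpen {w | ∃ t' ≥ t, coeffAt pre.length (ρ w t') ≠ coeffAt pre.length (ρ w t)} := by
    simp only [Set.ofPred_exists]
    exact isOpen_iUnion fun t' => (hρ t').comp₂ (hρ t) (fun r' r =>
      t' ≥ t ∧ coeffAt pre.length r' ≠ coeffAt pre.length r) {P | P}
  exact ((eventually_countable_ball (Set.to_countable (Set.Ici s))).2 fun t ht =>
    eventually_residual_mem_of_subset_closure (hopen t) (hclosure t ht)).mono
      fun w hw hwO t ht => hw t ht hwO

end Columns

/-! ### Solutions as descending chains -/

section LinearOrder

variable {X : Set ℕ} {le : ℕ → ℕ → Prop} {a b c : ℕ}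

theorem strict_of_not_le (hX : IsLinearOrder X fun a b : X => le a b) (ha : a ∈ X) (hb : b ∈ X)
    (h : ¬le a b) : strict le b a :=
  ⟨(hX.total ⟨a, ha⟩ ⟨b, hb⟩).resolve_left h, h⟩

theorem strict_of_strict_of_le (hX : IsLinearOrder X fun a b : X => le a b) (ha : a ∈ X)
    (hb : b ∈ X) (hc : c ∈ X) (hab : strict le a b) (hbc : le b c) : strict le a c :=
  ⟨hX.trans ⟨a, ha⟩ ⟨b, hb⟩ ⟨c, hc⟩ hab.1 hbc,
    fun hca => hab.2 (hX.trans ⟨b, hb⟩ ⟨c, hc⟩ ⟨a, ha⟩ hbc hca)⟩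

end LinearOrder

section Drops

/-- The coefficient `x.2` occurs in the term with index `x.1` of the instance `p`. -/
def Occurs (p : ℕ → ℕ) (x : ℕ × ℕ) : Prop := ∃ b, (b, x.2) ∈ termSeq p x.1

/-- A single step of a solution to the instance `p`: the occurrence `y` of a coefficient comes no
earlier than the occurrence `x` and is strictly smaller. A chain of these steps is a solution, and
`x` is inaccessible for this relation if and only if a solution starts at `x`. -/
def Drop (p : ℕ → ℕ) (y x : ℕ × ℕ) : Prop :=
  Occurs p x ∧ Occurs p y ∧ x.1 ≤ y.1 ∧ strict (orderRel p) y.2 x.2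

theorem exists_chain_extending {α : Type*} {r : α → α → Prop} {d : ℕ → α} {k : ℕ}
    (hd : ∀ i < k, r (d (i + 1)) (d i)) (hk : ¬Acc r (d k)) :
    ∃ e : ℕ → α, (∀ i, r (e (i + 1)) (e i)) ∧ ∀ i ≤ k, e i = d i := by
  obtain ⟨f, hf₀, hf⟩ := not_acc_iff_exists_descending_chain.1 hk
  refine ⟨fun i => if i < k then d i else f (i - k), fun i => ?_, fun i hi => ?_⟩
  · obtain h | rfl | h := lt_trichotomy (i + 1) k
    · simpa [h, i.lt_succ_self.trans h] using hd i (i.lt_succ_self.trans h)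
    · simpa [hf₀] using hd i i.lt_succ_self
    · simpa [h.not_gt, (Nat.lt_succ_iff.1 h).not_gt, Nat.sub_add_comm (Nat.lt_succ_iff.1 h)]
        using hf (i - k)
  · obtain h | rfl := hi.lt_or_eq
    · simp [h]
    · simp [hf₀]

theorem not_acc_of_chain {α : Type*} {r : α → α → Prop} {d : ℕ → α}
    (hd : ∀ i, r (d (i + 1)) (d i)) (k : ℕ) : ¬Acc r (d k) :=
  not_acc_iff_exists_descending_chain.2 ⟨fun i => d (k + i), rfl, fun i => hd (k + i)⟩

variable {p : ℕ → ℕ}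

theorem Occurs.mem_carrier (hp : WOPpowOmega.IsInstance p) {x : ℕ × ℕ} (hx : Occurs p x) :
    x.2 ∈ carrier p :=
  hx.elim fun _ h => ((hp.2.1 x.1).2 _ h).1

theorem isSolution_of_chain (hp : WOPpowOmega.IsInstance p) {d : ℕ → ℕ × ℕ}
    (hd : ∀ i, Drop p (d (i + 1)) (d i)) : WOPpowOmega.IsSolution p fun i => (d i).2 :=
  ⟨fun i => (hd i).1.mem_carrier hp, fun i => (hd i).2.2.2, fun i => (d i).1,
    monotone_nat_of_le_succ fun i => (hd i).2.2.1, fun i => (hd i).1⟩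

theorem orderRel_of_acc_of_not_acc (hp : WOPpowOmega.IsInstance p) {x y : ℕ × ℕ}
    (hx : Occurs p x) (hy : Occurs p y) (hxy : x.1 ≤ y.1) (hacc : Acc (Drop p) x)
    (hnot_acc : ¬Acc (Drop p) y) : orderRel p x.2 y.2 :=
  by_contra fun h => hnot_acc (hacc.inv
    ⟨hx, hy, hxy, strict_of_not_le hp.1 (hx.mem_carrier hp) (hy.mem_carrier hp) h⟩)

namespace IsColumn

variable {pre : List (ℕ × ℕ)} {b s : ℕ}

theorem occurs (hcol : IsColumn (termSeq p) pre b s) {t : ℕ} (ht : s ≤ t) :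
    Occurs p (t, coeffAt pre.length (termSeq p t)) := by
  obtain ⟨c, r, h⟩ := hcol t ht
  exact ⟨b, by simp [h]⟩

theorem orderRel_coeffAt (hp : WOPpowOmega.IsInstance p) (hcol : IsColumn (termSeq p) pre b s)
    {t t' a : ℕ} (ht : s ≤ t) (htt' : t ≤ t') (ha : a ∈ carrier p)
    (hle : orderRel p (coeffAt pre.length (termSeq p t)) a) :
    orderRel p (coeffAt pre.length (termSeq p t')) a := by
  induction t', htt' using Nat.le_induction with
  | base => exact hle
  | succ t' htt' ih =>
    have ht' : s ≤ t' := ht.trans htt'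
    have hmem := (hcol.occurs ht').mem_carrier hp
    have hmem' := (hcol.occurs (ht'.trans t'.le_succ)).mem_carrier hp
    refine hp.1.trans ⟨_, hmem'⟩ ⟨_, hmem⟩ ⟨a, ha⟩ ?_ ih
    obtain ⟨c, r, h⟩ := hcol t' ht'
    obtain ⟨c', r', h'⟩ := hcol (t' + 1) (ht'.trans t'.le_succ)
    have hdec := hp.2.2 t'
    rw [h, h', termLT_append_left_iff] at hdec
    obtain rfl | hlt := eq_or_strict_of_termLT_cons hdec
    · simpa [h, h'] using hp.1.refl ⟨_, hmem⟩
    · simpa [h, h'] using hlt.1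

theorem orderRel_coeffAt_self (hp : WOPpowOmega.IsInstance p)
    (hcol : IsColumn (termSeq p) pre b s) {t : ℕ} (ht : s ≤ t) :
    orderRel p (coeffAt pre.length (termSeq p t)) (coeffAt pre.length (termSeq p t)) :=
  hp.1.refl ⟨_, (hcol.occurs ht).mem_carrier hp⟩

theorem drop (hp : WOPpowOmega.IsInstance p) (hcol : IsColumn (termSeq p) pre b s) {x : ℕ × ℕ}
    (hx : Occurs p x) (hs : s ≤ x.1)
    (hle : orderRel p (coeffAt pre.length (termSeq p x.1)) x.2) {t : ℕ} (ht : x.1 ≤ t)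
    (hne : coeffAt pre.length (termSeq p t) ≠ coeffAt pre.length (termSeq p x.1)) :
    Drop p (t, coeffAt pre.length (termSeq p t)) x := by
  have hmem := (hcol.occurs hs).mem_carrier hp
  have hmem' := (hcol.occurs (hs.trans ht)).mem_carrier hp
  have hle' := hcol.orderRel_coeffAt hp hs ht hmem (hcol.orderRel_coeffAt_self hp hs)
  refine ⟨hx, hcol.occurs (hs.trans ht), ht, strict_of_strict_of_le hp.1 hmem' hmem
    (hx.mem_carrier hp) ⟨hle', fun h => hne ?_⟩ hle⟩
  exact congrArg Subtype.val (hp.1.antisymm ⟨_, hmem'⟩ ⟨_, hmem⟩ hle' h)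

theorem exists_chain (hp : WOPpowOmega.IsInstance p) (hcol : IsColumn (termSeq p) pre b s)
    (hvar : CoeffVaries (termSeq p) pre.length s) {T : ℕ} (hT : s ≤ T) :
    ∃ τ : ℕ → ℕ, τ 0 = T ∧ (∀ i, s ≤ τ i) ∧
      ∀ i, Drop p (τ (i + 1), coeffAt pre.length (termSeq p (τ (i + 1))))
        (τ i, coeffAt pre.length (termSeq p (τ i))) := by
  choose next hle hne using fun t : Set.Ici s => hvar t t.2
  let τ (i : ℕ) : Set.Ici s := (fun t => ⟨next t, t.2.trans (hle t)⟩)^[i] ⟨T, hT⟩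
  have hτ (i : ℕ) : (τ (i + 1) : ℕ) = next (τ i) :=
    congrArg Subtype.val (Function.iterate_succ_apply' _ i _)
  refine ⟨fun i => τ i, rfl, fun i => (τ i).2, fun i => ?_⟩
  simp only [hτ]
  exact hcol.drop hp (hcol.occurs (τ i).2) (τ i).2 (hcol.orderRel_coeffAt_self hp (τ i).2)
    (hle _) (hne _)

theorem not_acc (hp : WOPpowOmega.IsInstance p) (hcol : IsColumn (termSeq p) pre b s)
    (hvar : CoeffVaries (termSeq p) pre.length s) {x : ℕ × ℕ} (hx : Occurs p x) {t : ℕ}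
    (hs : s ≤ t) (ht : t ≤ x.1) (hle : orderRel p (coeffAt pre.length (termSeq p t)) x.2) :
    ¬Acc (Drop p) x := by
  obtain ⟨t', ht', hne⟩ := hvar x.1 (hs.trans ht)
  obtain ⟨τ, rfl, -, hτ⟩ := hcol.exists_chain hp hvar (hs.trans (ht.trans ht'))
  have hle' := hcol.orderRel_coeffAt hp hs ht (hx.mem_carrier hp) hle
  exact fun h => not_acc_of_chain (d := fun i => (τ i, coeffAt pre.length (termSeq p (τ i)))) hτ 0
    (h.inv (hcol.drop hp hx (hs.trans ht) hle' ht' hne))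

end IsColumn

theorem exists_not_acc_drop (hp : WOPpowOmega.IsInstance p) (T : ℕ) :
    ∃ x : ℕ × ℕ, T ≤ x.1 ∧ ¬Acc (Drop p) x := by
  obtain ⟨O, hO, hne, pre, b, s, hcol, hvar⟩ :=
    exists_isColumn_coeffVaries (W := Unit) (ρ := fun _ => termSeq p)
      (fun _ => IsLocallyConstant.const _) (fun _ => hp.2.2) fun _ t => (hp.2.1 t).1
  obtain ⟨u, hu, hvaru⟩ := (dense_of_mem_residual hvar).inter_open_nonempty O hO hne
  have hs : s ≤ max T s := le_max_right T s
  exact ⟨(max T s, _), le_max_left T s, (hcol u hu).not_acc hp (hvaru hu)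
    ((hcol u hu).occurs hs) hs le_rfl ((hcol u hu).orderRel_coeffAt_self hp hs)⟩

end Drops

/-! ### Continuous families of instances -/

section Families

variable {W : Type*} [TopologicalSpace W] {U : W → ℕ → ℕ}

theorem isLocallyConstant_termSeq (hU : Continuous U) (t : ℕ) :
    IsLocallyConstant fun w => termSeq (U w) t :=
  have hcont : Continuous fun w => sndPart (sndPart (U w)) t := by fun_prop
  (IsLocallyConstant.iff_continuous _ |>.2 hcont).comp (Denumerable.ofNat (List (ℕ × ℕ)))

theorem isLocallyConstant_orderRel (hU : Continuous U) (a b : ℕ) :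
    IsLocallyConstant fun w => orderRel (U w) a b :=
  have hcont : Continuous fun w => fstPart (sndPart (U w)) (Nat.pair a b) := by fun_prop
  (IsLocallyConstant.iff_continuous _ |>.2 hcont).comp (· = 1)

theorem isLocallyConstant_occurs (hU : Continuous U) (x : ℕ × ℕ) :
    IsLocallyConstant fun w => Occurs (U w) x :=
  (isLocallyConstant_termSeq hU x.1).comp fun s => ∃ b, (b, x.2) ∈ s

theorem isLocallyConstant_drop (hU : Continuous U) (y x : ℕ × ℕ) :
    IsLocallyConstant fun w => Drop (U w) y x := by
  have hstrict : IsLocallyConstant fun w => strict (orderRel (U w)) y.2 x.2 :=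
    (isLocallyConstant_orderRel hU y.2 x.2).comp₂ (isLocallyConstant_orderRel hU x.2 y.2)
      fun P Q => P ∧ ¬Q
  exact (isLocallyConstant_occurs hU x).comp₂ ((isLocallyConstant_occurs hU y).comp₂
    (hstrict.comp (x.1 ≤ y.1 ∧ ·)) And) And

/-- A value of the computed solution depends on finitely many steps of the chain only, and these
can be continued differently at each nearby parameter where the last of them is inaccessible. -/
theorem ContinuousWeihrauchLE.exists_family {P : Problem}
    (hP : ContinuousWeihrauchLE P WOPpowOmega) {x : W → ℕ → ℕ} (hx : Continuous x)
    (hxP : ∀ w, P.IsInstance (x w)) :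
    ∃ U : W → ℕ → ℕ, Continuous U ∧ (∀ w, WOPpowOmega.IsInstance (U w)) ∧
      ∀ (w : W) (d : ℕ → ℕ × ℕ), (∀ i, Drop (U w) (d (i + 1)) (d i)) → ∃ y, P.IsSolution (x w) y ∧
        ∀ n, ∃ k, ∀ᶠ w' in 𝓝 w, ¬Acc (Drop (U w')) (d k) →
          ∃ y', P.IsSolution (x w') y' ∧ y' n = y n := by
  obtain ⟨H, K, hH, hK, hred⟩ := hP
  choose U hU hUinst hsol using fun w => hred (x w) (hxP w)
  have hUcont : Continuous U := hH.continuous_of_maps hx hU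
  refine ⟨U, hUcont, hUinst, fun w d hd => ?_⟩
  obtain ⟨y, hy, hysol⟩ := hsol w _ (isSolution_of_chain (hUinst w) hd)
  refine ⟨y, hysol, fun n => ?_⟩
  obtain ⟨k, hk⟩ := hK.exists_modulus hx (hy n)
  have hdrops : ∀ᶠ w' in 𝓝 w, ∀ i < k, Drop (U w') (d (i + 1)) (d i) :=
    (Set.finite_Iio k).eventually_all.2 fun i _ =>
      ((isLocallyConstant_drop hUcont _ _).eventually_eq w).mono fun w' h => h.symm ▸ hd i
  refine ⟨k, (hk.and hdrops).mono fun w' ⟨hval, hd'⟩ hacc => ?_⟩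
  obtain ⟨e, he, hed⟩ := exists_chain_extending hd' hacc
  obtain ⟨y', hy', hysol'⟩ := hsol w' _ (isSolution_of_chain (hUinst w') he)
  exact ⟨y', hysol', Part.mem_unique (hy' n) (hval _ fun i hi => by rw [hed i hi.le])⟩

theorem exists_chain_forall_near [BaireSpace W] [Nonempty W] (hU : Continuous U)
    (hUinst : ∀ w, WOPpowOmega.IsInstance (U w)) :
    ∃ (w₁ : W) (d : ℕ → ℕ × ℕ), (∀ i, Drop (U w₁) (d (i + 1)) (d i)) ∧
      ∀ k, ∀ᶠ w₂ in 𝓝 w₁, Acc (Drop (U w₂)) (d k) →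
        ∃ e : ℕ → ℕ × ℕ, (∀ i, Drop (U w₂) (e (i + 1)) (e i)) ∧
          ∀ k, ∀ᶠ w₃ in 𝓝 w₂ ⊓ residual W, ¬Acc (Drop (U w₃)) (e k) := by
  obtain ⟨O, hO, hne, pre, b, s, hcol, hvar⟩ := exists_isColumn_coeffVaries
    (isLocallyConstant_termSeq hU) (fun w => (hUinst w).2.2) fun w t => ((hUinst w).2.1 t).1
  have hcoeff (w : W) (t : ℕ) : ∀ᶠ w' in 𝓝 w,
      coeffAt pre.length (termSeq (U w') t) = coeffAt pre.length (termSeq (U w) t) :=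
    ((isLocallyConstant_termSeq hU t).comp (coeffAt pre.length)).eventually_eq w
  obtain ⟨w₁, hw₁, hvar₁⟩ := (dense_of_mem_residual hvar).inter_open_nonempty O hO hne
  obtain ⟨τ, -, hsτ, hτ⟩ := (hcol w₁ hw₁).exists_chain (hUinst w₁) (hvar₁ hw₁) le_rfl
  refine ⟨w₁, _, hτ, fun k => ?_⟩
  filter_upwards [hO.eventually_mem hw₁, hcoeff w₁ (τ k)] with w₂ hw₂ hk hacc
  obtain ⟨x, hx, hxacc⟩ := exists_not_acc_drop (hUinst w₂) (τ k)
  obtain ⟨e, rfl, he⟩ := not_acc_iff_exists_descending_chain.1 hxacc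
  refine ⟨e, he, fun k' => ?_⟩
  have hindex : τ k ≤ (e k').1 :=
    hx.trans (monotone_nat_of_le_succ (fun i => (he i).2.2.1) k'.zero_le)
  rw [← hk] at hacc
  have hle : orderRel (U w₂) (coeffAt pre.length (termSeq (U w₂) (τ k))) (e k').2 :=
    orderRel_of_acc_of_not_acc (x := (τ k, _)) (hUinst w₂) ((hcol w₂ hw₂).occurs (hsτ k))
      (he k').1 hindex hacc (not_acc_of_chain he k')
  filter_upwards [(hO.eventually_mem hw₂).filter_mono inf_le_left, hvar.filter_mono inf_le_right,
    (hcoeff w₂ (τ k)).filter_mono inf_le_left,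
    ((isLocallyConstant_orderRel hU _ _).eventually_eq w₂).filter_mono inf_le_left,
    ((isLocallyConstant_occurs hU (e k')).eventually_eq w₂).filter_mono inf_le_left]
    with w₃ hw₃ hvar₃ hcoeff₃ hle₃ hoccurs₃
  refine (hcol w₃ hw₃).not_acc (hUinst w₃) (hvar₃ hw₃) ?_ (hsτ k) hindex ?_
  · exact hoccurs₃.symm ▸ (he k').1
  · rw [hcoeff₃]
    exact hle₃.symm ▸ hle

end Families

/-! ### The family of instances -/

section CodeInstance

open Encodable Denumerable

variable {α : Type*} [LinearOrder α] [Denumerable α]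

/-- The instance of `WOPpowOmega` that consists of the linear order `α`, transported to `ℕ` along
its enumeration, and of the sequence `σ` in `α ^ ω`. -/
def codeInstance (σ : ℕ → List (ℕ × α)) : ℕ → ℕ :=
  join (fun _ => 1)
    (join (fun m => if ofNat α m.unpair.1 ≤ ofNat α m.unpair.2 then 1 else 0)
      fun t => encode ((σ t).map (Prod.map id encode)))

variable {σ : ℕ → List (ℕ × α)}

@[simp]
theorem carrier_codeInstance : carrier (codeInstance σ) = Set.univ := by
  simp [carrier, codeInstance]

@[simp]
theorem orderRel_codeInstance {a b : ℕ} :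
    orderRel (codeInstance σ) a b ↔ ofNat α a ≤ ofNat α b := by
  simp [orderRel, codeInstance]

@[simp]
theorem strict_orderRel_codeInstance {a b : ℕ} :
    strict (orderRel (codeInstance σ)) a b ↔ ofNat α a < ofNat α b := by
  simp only [strict, orderRel_codeInstance, ← lt_iff_le_not_ge]

@[simp]
theorem termSeq_codeInstance (t : ℕ) :
    termSeq (codeInstance σ) t = (σ t).map (Prod.map id encode) := by
  simp only [termSeq, codeInstance, sndPart_join, ofNat_encode]

theorem termLT_codeInstance {τ τ' : List (ℕ × α)}
    (h : List.Lex (Prod.Lex (· < ·) (· < ·)) τ' τ) :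
    termLT (orderRel (codeInstance σ)) (τ'.map (Prod.map id encode))
      (τ.map (Prod.map id encode)) := by
  induction h with
  | nil => exact .nil
  | cons _ ih => exact .cons ih
  | rel h => exact .rel (by simpa [Prod.lex_def] using h)

theorem isInstance_codeInstance [NoMinOrder α]
    (hexp : ∀ t, ((σ t).map Prod.fst).Pairwise (· > ·))
    (hdec : ∀ t, List.Lex (Prod.Lex (· < ·) (· < ·)) (σ (t + 1)) (σ t)) :
    WOPpowOmega.IsInstance (codeInstance σ) := by
  refine ⟨?_, fun t => ⟨?_, ?_⟩, fun t => ?_⟩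
  · exact
      { refl a := by simp
        trans a b c := by simpa using le_trans
        antisymm a b := by
          simp only [orderRel_codeInstance]
          exact fun hab hba => Subtype.ext ((Denumerable.eqv α).symm.injective (hab.antisymm hba))
        total a b := by simpa using le_total _ _ }
  · simpa [Function.comp_def] using hexp t
  · simp only [termSeq_codeInstance, List.mem_map, carrier_codeInstance, Set.mem_univ, true_and,
      strict_orderRel_codeInstance]
    rintro _ ⟨u, -, rfl⟩
    obtain ⟨c, hc⟩ := exists_lt u.2
    exact ⟨encode c, by simpa using hc⟩
  · simpa using termLT_codeInstance (hdec t)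

theorem strictAnti_of_isSolution_codeInstance {y : ℕ → ℕ}
    (hy : WOPpowOmega.IsSolution (codeInstance σ) y) : StrictAnti fun i => ofNat α (y i) :=
  strictAnti_nat_of_succ_lt fun i => by simpa using hy.2.1 i

theorem exists_mem_of_isSolution_codeInstance {y : ℕ → ℕ}
    (hy : WOPpowOmega.IsSolution (codeInstance σ) y) (i : ℕ) :
    ∃ t b, (b, ofNat α (y i)) ∈ σ t := by
  obtain ⟨t, -, ht⟩ := hy.2.2
  obtain ⟨b, hb⟩ := ht i
  rw [termSeq_codeInstance, List.mem_map] at hb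
  obtain ⟨⟨b, a⟩, hmem, heq⟩ := hb
  have hya : encode a = y i := congrArg Prod.snd heq
  exact ⟨t i, b, by rwa [← hya, ofNat_encode]⟩

theorem continuous_codeInstance {W : Type*} [TopologicalSpace W] {σ : W → ℕ → List (ℕ × α)}
    (hσ : ∀ t, IsLocallyConstant fun w => σ w t) : Continuous fun w => codeInstance (σ w) := by
  have hterms (t : ℕ) : Continuous fun w => encode ((σ w t).map (Prod.map id encode)) :=
    ((hσ t).comp fun s => encode (s.map (Prod.map id encode))).continuous
  unfold codeInstance
  fun_prop

end CodeInstance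

section DropTimes

/-- The linear order of the instances in which `WOPpowOmega` is used: `ω + 1` copies of the reversed
natural numbers, the copy at `⊤` being the topmost one. -/
abbrev Block : Type := WithTop ℕ ×ₗ ℕᵒᵈ

instance : Denumerable Block := inferInstanceAs (Denumerable (Option ℕ × ℕ))

/-- The number of times before `t` at which `w` is `true`. -/
def dropCount (w : ℕ → Bool) (t : ℕ) : ℕ := Nat.count (w · = true) t

theorem dropCount_succ (w : ℕ → Bool) (t : ℕ) :
    dropCount w (t + 1) = dropCount w t + if w t then 1 else 0 :=
  Nat.count_succ _ _

theorem isLocallyConstant_dropCount (t : ℕ) :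
    IsLocallyConstant fun w : ℕ → Bool => dropCount w t := by
  induction t with
  | zero => exact IsLocallyConstant.const _
  | succ t ih =>
    simp only [dropCount_succ]
    exact ih.comp₂ ((IsLocallyConstant.iff_continuous _).2 (continuous_apply t))
      fun m b => m + if b then 1 else 0

/-- The decreasing sequence in `Block ^ ω` with drop times `w`. At a drop time its leading
coefficient decreases within the topmost copy, and the second coefficient, free to grow, starts anew
in a higher copy; at all other times the second coefficient decreases within its copy. -/
def dropSeq (w : ℕ → Bool) (t : ℕ) : List (ℕ × Block) :=
  [(1, toLex (⊤, OrderDual.toDual (dropCount w t))),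
    (0, toLex (↑(dropCount w t), OrderDual.toDual t))]

theorem isLocallyConstant_dropSeq (t : ℕ) :
    IsLocallyConstant fun w : ℕ → Bool => dropSeq w t :=
  (isLocallyConstant_dropCount t).comp fun m : ℕ =>
    ([(1, toLex (⊤, OrderDual.toDual m)), (0, toLex (↑m, OrderDual.toDual t))] :
      List (ℕ × Block))

theorem pairwise_map_fst_dropSeq (w : ℕ → Bool) (t : ℕ) :
    ((dropSeq w t).map Prod.fst).Pairwise (· > ·) := by
  simp [dropSeq]

theorem dropSeq_succ_lt (w : ℕ → Bool) (t : ℕ) :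
    List.Lex (Prod.Lex (· < ·) (· < ·)) (dropSeq w (t + 1)) (dropSeq w t) := by
  unfold dropSeq
  rw [dropCount_succ]
  cases w t
  · exact .cons (.rel (.right _ (Prod.Lex.toLex_lt_toLex.2 (.inr ⟨rfl, t.lt_succ_self⟩))))
  · exact .rel (.right _ (Prod.Lex.toLex_lt_toLex.2 (.inr ⟨rfl, Nat.lt_succ_self _⟩)))

theorem mem_dropSeq {w : ℕ → Bool} {t b : ℕ} {a : Block} (h : (b, a) ∈ dropSeq w t) :
    a = toLex (⊤, OrderDual.toDual (dropCount w t)) ∨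
      a = toLex (↑(dropCount w t), OrderDual.toDual t) := by
  simp only [dropSeq, List.mem_cons, Prod.mk.injEq, List.not_mem_nil, or_false] at h
  exact h.imp And.right And.right

theorem exists_fst_ne_top_of_finite {w : ℕ → Bool} (hw : {t | w t = true}.Finite) {a : ℕ → Block}
    (ha : StrictAnti a) (hmem : ∀ i, ∃ t b, (b, a i) ∈ dropSeq w t) :
    ∃ i, (ofLex (a i)).1 ≠ ⊤ := by
  by_contra! htop
  refine Set.infinite_of_injective_forall_mem ha.injective (fun i => ?_)
    ((Set.finite_Iic hw.toFinset.card).image fun m => toLex (⊤, OrderDual.toDual m))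
  obtain ⟨t, b, h⟩ := hmem i
  obtain h | h := mem_dropSeq h
  · exact ⟨_, Nat.count_le_card hw t, h.symm⟩
  · simpa [h] using htop i

theorem fst_eq_top_of_infinite {w : ℕ → Bool} (hw : {t | w t = true}.Infinite) {a : ℕ → Block}
    (ha : StrictAnti a) (hmem : ∀ i, ∃ t b, (b, a i) ∈ dropSeq w t) (i : ℕ) :
    (ofLex (a i)).1 = ⊤ := by
  by_contra hne
  obtain ⟨m, hm⟩ := WithTop.ne_top_iff_exists.1 hne
  refine Set.infinite_of_injective_forall_mem (ha.injective.comp (add_left_injective i))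
    (fun j => ?_) ((Set.finite_Iic (Nat.nth (w · = true) m)).image fun t =>
      toLex ((dropCount w t : WithTop ℕ), OrderDual.toDual t))
  have hle : (ofLex (a (j + i))).1 ≤ m :=
    (Prod.Lex.monotone_fst _ _ (ha.antitone (Nat.le_add_left i j))).trans_eq hm.symm
  obtain ⟨t, b, h⟩ := hmem (j + i)
  obtain h | h := mem_dropSeq h
  · simp [h] at hle
  · rw [h] at hle
    exact ⟨t, (Nat.count_le_iff_le_nth hw).1 (WithTop.coe_le_coe.1 hle), h.symm⟩

end DropTimes

section Separation

/-- The instance of `ECT` that is the colouring `w` of the natural numbers with two colours. -/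
def colouring (w : ℕ → Bool) : ℕ → ℕ
  | 0 => 2
  | i + 1 => (w i).toNat

theorem isInstance_colouring (w : ℕ → Bool) : ECT.IsInstance (colouring w) :=
  fun i => Bool.toNat_lt (w i)

theorem continuous_colouring : Continuous colouring := by
  refine continuous_pi fun n => ?_
  cases n with
  | zero => exact continuous_const
  | succ i =>
    exact (continuous_of_discreteTopology (f := Bool.toNat)).comp (continuous_apply i)

theorem le_of_isSolution_colouring {w : ℕ → Bool} {y : ℕ → ℕ} {n : ℕ} (hn : w n = true)
    (hlast : ∀ i > n, w i = false) (hy : ECT.IsSolution (colouring w) y) : n ≤ y 0 := by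
  by_contra! hlt
  obtain ⟨z, hz, heq⟩ := hy n hlt
  simp [colouring, hn, hlast z hz] at heq

theorem eventually_residual_infinite_true :
    ∀ᶠ w in residual (ℕ → Bool), {t | w t = true}.Infinite := by
  have hopen (n : ℕ) : IsOpen {w : ℕ → Bool | ∃ t ≥ n, w t = true} := by
    simp only [Set.ofPred_exists]
    exact isOpen_iUnion fun t =>
      isOpen_const.inter ((isOpen_discrete {b : Bool | b = true}).preimage
        (continuous_apply (A := fun _ : ℕ => Bool) t))
  have hdense (n : ℕ) : Dense {w : ℕ → Bool | ∃ t ≥ n, w t = true} := fun w =>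
    mem_closure_of_tendsto
      (tendsto_nhds_of_forall_lt_eq (g := fun m i => if i < m then w i else true)
        fun m i hi => if_pos hi)
      (.of_forall fun m => ⟨max m n, le_max_right m n, by simp⟩)
  have hunbounded : ∀ᶠ w in residual (ℕ → Bool), ∀ n, ∃ t ≥ n, w t = true :=
    eventually_countable_forall.2 fun n => residual_of_dense_open (hopen n) (hdense n)
  filter_upwards [hunbounded] with w hw
  exact Nat.frequently_atTop_iff_infinite.1 (frequently_atTop.2 hw)

/-- The instance of `ECT.prod WOPpowOmega` with parameter `w`. The same bits serve as the colouring
and as the drop times. -/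
def productInstance (w : ℕ → Bool) : ℕ → ℕ :=
  join (colouring w) (codeInstance (dropSeq w))

theorem isInstance_productInstance (w : ℕ → Bool) :
    (ECT.prod WOPpowOmega).IsInstance (productInstance w) := by
  simpa [Problem.prod, productInstance] using And.intro (isInstance_colouring w)
    (isInstance_codeInstance (pairwise_map_fst_dropSeq w) (dropSeq_succ_lt w))

theorem isSolution_productInstance {w : ℕ → Bool} {y : ℕ → ℕ} :
    (ECT.prod WOPpowOmega).IsSolution (productInstance w) y ↔
      ECT.IsSolution (colouring w) (fstPart y) ∧
        WOPpowOmega.IsSolution (codeInstance (dropSeq w)) (sndPart y) := by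
  simp [Problem.prod, productInstance]

theorem continuous_productInstance : Continuous productInstance :=
  continuous_join continuous_colouring (continuous_codeInstance isLocallyConstant_dropSeq)

/-- The copy of the reversed natural numbers to which the `i`-th entry of `y` belongs, when `y` is
read as a sequence of codes of elements of `Block`. -/
def level (y : ℕ → ℕ) (i : ℕ) : WithTop ℕ :=
  (ofLex (Denumerable.ofNat Block (y i))).1

theorem exists_level_ne_top {w : ℕ → Bool} (hw : {t | w t = true}.Finite) {y : ℕ → ℕ}
    (hy : WOPpowOmega.IsSolution (codeInstance (dropSeq w)) y) : ∃ i, level y i ≠ ⊤ :=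
  exists_fst_ne_top_of_finite hw (strictAnti_of_isSolution_codeInstance hy)
    (exists_mem_of_isSolution_codeInstance hy)

theorem level_eq_top {w : ℕ → Bool} (hw : {t | w t = true}.Infinite) {y : ℕ → ℕ}
    (hy : WOPpowOmega.IsSolution (codeInstance (dropSeq w)) y) (i : ℕ) : level y i = ⊤ :=
  fst_eq_top_of_infinite hw (strictAnti_of_isSolution_codeInstance hy)
    (exists_mem_of_isSolution_codeInstance hy) i

theorem exists_last_true_of_mem_nhds {w : ℕ → Bool} {s : Set (ℕ → Bool)} (hs : s ∈ 𝓝 w) (b : ℕ) :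
    ∃ w' ∈ s, ∃ n > b, w' n = true ∧ ∀ i > n, w' i = false := by
  have htendsto := tendsto_nhds_of_forall_lt_eq
    (g := fun n i => if i < n then w i else decide (i = n)) (f := w) fun n i hi => if_pos hi
  obtain ⟨n, hn, hb⟩ := ((htendsto.eventually_mem hs).and (eventually_gt_atTop b)).exists
  exact ⟨_, hn, n, hb, by simp, fun i hi => by simp [hi.not_gt, hi.ne']⟩

theorem not_continuousWeihrauchLE_ECT_prod_WOPpowOmega :
    ¬ContinuousWeihrauchLE (ECT.prod WOPpowOmega) WOPpowOmega := by
  intro h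
  obtain ⟨U, hU, hUinst, hsol⟩ :=
    h.exists_family continuous_productInstance isInstance_productInstance
  obtain ⟨w₁, d, hd, hnear⟩ := exists_chain_forall_near hU hUinst
  obtain ⟨y₁, -, hy₁⟩ := hsol w₁ d hd
  obtain ⟨k₁, hk₁⟩ := hy₁ 0
  obtain ⟨w₂, ⟨hsol₂, hnear₂⟩, n, hn, hwn, hlast⟩ :=
    exists_last_true_of_mem_nhds (hk₁.and (hnear k₁)) (y₁ 0)
  have hacc : Acc (Drop (U w₂)) (d k₁) := by
    by_contra hnot_acc
    obtain ⟨y, hy, heq⟩ := hsol₂ hnot_acc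
    have hbound : n ≤ y 0 :=
      le_of_isSolution_colouring hwn hlast (isSolution_productInstance.1 hy).1
    exact (heq ▸ hbound).not_gt hn
  obtain ⟨e, he, hgeneric⟩ := hnear₂ hacc
  obtain ⟨y₂, hy₂, hy₂'⟩ := hsol w₂ e he
  have hfinite : {t | w₂ t = true}.Finite :=
    (Set.finite_Iic n).subset fun t (ht : w₂ t = true) =>
      Set.mem_Iic.2 (not_lt.1 fun hnt => by simp [hlast t hnt] at ht)
  obtain ⟨i, hi⟩ := exists_level_ne_top hfinite (isSolution_productInstance.1 hy₂).2
  obtain ⟨k₂, hk₂⟩ := hy₂' (2 * i + 1)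
  obtain ⟨w₃, ⟨hsol₃, hnot_acc₃⟩, hinfinite⟩ := (((hk₂.filter_mono inf_le_left).and
    (hgeneric k₂)).and (eventually_residual_infinite_true.filter_mono inf_le_right)).exists
  obtain ⟨y₃, hy₃, heq⟩ := hsol₃ hnot_acc₃
  have hlevel : level (sndPart y₃) i = level (sndPart y₂) i := by
    simp only [level, sndPart, heq]
  exact hi (hlevel ▸ level_eq_top hinfinite (isSolution_productInstance.1 hy₃).2 i)

end Separation

end Weihrauch

theorem mainTheorem12_general :
    Weihrauch.WeihrauchLE Weihrauch.WOPpowOmega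
        (Weihrauch.Problem.prod Weihrauch.ECT Weihrauch.WOPpowOmega) ∧
      ¬Weihrauch.ContinuousWeihrauchLE
        (Weihrauch.Problem.prod Weihrauch.ECT Weihrauch.WOPpowOmega) Weihrauch.WOPpowOmega :=
  ⟨Weihrauch.weihrauchLE_ECT_prod _, Weihrauch.not_continuousWeihrauchLE_ECT_prod_WOPpowOmega⟩

theorem mainTheorem12 :
    Weihrauch.WeihrauchLT Weihrauch.WOPpowOmega
      (Weihrauch.Problem.prod Weihrauch.ECT Weihrauch.WOPpowOmega) :=
  mainTheorem12_general.imp_right (mt Weihrauch.WeihrauchLE.continuousWeihrauchLE)
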